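/- Let $p\le m$. Consider the port-Hamiltonian plant with state $x=(x_1,x_2)\in\mathbb{R}^m\times\mathbb{R}^p$, input $u\in\mathbb{R}^m$ and constant unmatched disturbance $d_2\in\mathbb{R}^p$, $$\dot x_1=(J_1-R_1)\nabla_{x_1}H+J_{12}\nabla_{x_2}H+u,\qquad \dot x_2=-J_{12}^\top\nabla_{x_1}H+(J_2-R_2)\nabla_{x_2}H-d_2,$$ where $J_1,R_1\in\mathbb{R}^{m\times m}$, $J_{12}\in\mathbb{R}^{m\times p}$ and $J_2,R_2\in\mathbb{R}^{p\times p}$ depend smoothly on $x$, $J_1=-J_1^\top$, $J_2=-J_2^\top$, $R_1=R_1^\top>0$, $R_2=R_2^\top\ge 0$, and $H:\mathbb{R}^{m+p}\to\mathbb{R}$ is smooth with a strict minimum at $(x_1^*,x_2^*)$. Close the loop with the dynamic controller with state $\zeta\in\mathbb{R}^p$, $$u=(J_1-R_1)\nabla_{x_1}\big[H_c(E^\top x_1-\zeta)\big],\qquad \dot\zeta=E^\top J_{12}\nabla_{x_2}H,$$ where $E\in\mathbb{R}^{m\times p}$ is a constant matrix of full rank and $H_c:\mathbb{R}^p\to\mathbb{R}$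 is continuously differentiable and strictly convex with $\nabla H_c:\mathbb{R}^p\to\mathbb{R}^p$ bijective. Assume that 1. $J_{12}$ and $R_1$ have full rank; 2. $\nabla_{x_1x_2}H=0$ identically; 3. $H$ is strongly convex; 4. $J_{12}$ is constant, and $J_{12}^\top E$ is invertible; 5. there is a unique $\bar x_1\in\mathbb{R}^m$ with $\nabla_{x_1}H(\bar x_1,x_2^*)=-E(J_{12}^\top E)^{-1}d_2$. Put $H_{cl}(x_1,x_2,\zeta)=H(x_1,x_2)+H_c(E^\top x_1-\zeta)$. Then there is exactly one point at which $$\big(\nabla_{x_1}H_{cl},\nabla_{x_2}H_{cl},\nabla_\zeta H_{cl}\big)=\big(0,\,0,\,-(J_{12}^\top E)^{-1}d_2\big);$$ it has the form $(\bar x_1,x_2^*,\bar\zeta)$ for some $\bar\zeta\in\mathbb{R}^p$, and it is a globally asymptotically stable equilibrium of the closed loop: it is an equilibrium, every initial state admits a solution for all $t\ge 0$, every solution on a finite interval $[0,T)$ continues to $[0,\infty)$, the equilibrium is Lyapunov stable, and every solution on $[0,\infty)$ converges to it. -/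

import Mathlib

open Set Filter Topology Matrix
open scoped ContDiff

namespace PortHamiltonian

/-- Euclidean space of dimension `n`. -/
abbrev Vec (n : ℕ) : Type := EuclideanSpace ℝ (Fin n)

/-- A matrix acting on a Euclidean vector. -/
noncomputable def act {a b : ℕ} (A : Matrix (Fin a) (Fin b) ℝ) (v : Vec b) : Vec a :=
  WithLp.toLp 2 (A *ᵥ v.ofLp)

/-- A rectangular matrix has full rank if its rank is the smaller of its two dimensions. -/
def IsFullRank {a b : ℕ} (A : Matrix (Fin a) (Fin b) ℝ) : Prop :=
  A.rank = min a b

/-- Smooth dependence of a matrix on the state, entry by entry. -/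
def SmoothMatrix {m p a b : ℕ} (A : Vec m × Vec p → Matrix (Fin a) (Fin b) ℝ) : Prop :=
  ∀ i j, ContDiff ℝ ∞ (fun x => A x i j)

/-- Partial gradient with respect to the first block of the state. -/
noncomputable def grad₁ {m p : ℕ} (H : Vec m × Vec p → ℝ) (x : Vec m × Vec p) : Vec m :=
  gradient (fun y => H (y, x.2)) x.1

/-- Partial gradient with respect to the second block of the state. -/
noncomputable def grad₂ {m p : ℕ} (H : Vec m × Vec p → ℝ) (x : Vec m × Vec p) : Vec p :=
  gradient (fun y => H (x.1, y)) x.2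

/-- The class of port-Hamiltonian plants, with state `x = (x₁, x₂) ∈ ℝᵐ × ℝᵖ`. All matrices
may depend on the state. -/
structure Plant (m p : ℕ) where
  /-- the Hamiltonian -/
  H : Vec m × Vec p → ℝ
  J₁ : Vec m × Vec p → Matrix (Fin m) (Fin m) ℝ
  R₁ : Vec m × Vec p → Matrix (Fin m) (Fin m) ℝ
  J₁₂ : Vec m × Vec p → Matrix (Fin m) (Fin p) ℝ
  J₂ : Vec m × Vec p → Matrix (Fin p) (Fin p) ℝ
  R₂ : Vec m × Vec p → Matrix (Fin p) (Fin p) ℝ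
  /-- the minimizer `(x₁*, x₂*)` of the Hamiltonian -/
  xstar : Vec m × Vec p
  dim_le : p ≤ m
  smooth_H : ContDiff ℝ ∞ H
  smooth_J₁ : SmoothMatrix J₁
  smooth_R₁ : SmoothMatrix R₁
  smooth_J₁₂ : SmoothMatrix J₁₂
  smooth_J₂ : SmoothMatrix J₂
  smooth_R₂ : SmoothMatrix R₂
  skew_J₁ : ∀ x, J₁ x = -(J₁ x)ᵀ
  skew_J₂ : ∀ x, J₂ x = -(J₂ x)ᵀ
  /-- `R₁` is symmetric positive definite -/
  posDef_R₁ : ∀ x, (R₁ x).PosDef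
  /-- `R₂` is symmetric positive semidefinite -/
  posSemidef_R₂ : ∀ x, (R₂ x).PosSemidef
  strict_min : ∀ x, x ≠ xstar → H xstar < H x

/-- Right-hand side of the plant with input `u`, matched disturbance `d₁` and unmatched
disturbance `d₂`. -/
noncomputable def Plant.field {m p : ℕ} (P : Plant m p) (u d₁ : Vec m) (d₂ : Vec p)
    (x : Vec m × Vec p) : Vec m × Vec p :=
  (act (P.J₁ x - P.R₁ x) (grad₁ P.H x) + act (P.J₁₂ x) (grad₂ P.H x) + u - d₁,
   -act (P.J₁₂ x)ᵀ (grad₁ P.H x) + act (P.J₂ x - P.R₂ x) (grad₂ P.H x) - d₂)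

/-- The Hamiltonian has no cross terms: its mixed second derivative
`∇_{x₁x₂} H` vanishes identically. -/
def Plant.NoCrossTerms {m p : ℕ} (P : Plant m p) : Prop :=
  ∀ x : Vec m × Vec p, fderiv ℝ (fun y => grad₁ P.H (x.1, y)) x.2 = 0

/-- The Hamiltonian is strongly convex for the Euclidean norm of `ℝᵐ⁺ᵖ`. -/
def Plant.StronglyConvex {m p : ℕ} (P : Plant m p) : Prop :=
  ∃ c : ℝ, 0 < c ∧
    StrongConvexOn univ c (fun w : WithLp 2 (Vec m × Vec p) => P.H w.ofLp)

/-- Data of the integral controller: the constant full rank matrix `E` and the strictly convex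
function `Hc` on `ℝᵖ` whose gradient map is invertible. -/
structure Controller (m p : ℕ) where
  E : Matrix (Fin m) (Fin p) ℝ
  Hc : Vec p → ℝ
  fullRank_E : IsFullRank E
  contDiff_Hc : ContDiff ℝ 1 Hc
  strictConvex_Hc : StrictConvexOn ℝ univ Hc
  bijective_grad : Function.Bijective (fun z => gradient Hc z)

/-- The control law `u = (J₁ - R₁) ∇_{x₁} [Hc (Eᵀ x₁ - ζ)]`. -/
noncomputable def Controller.input {m p : ℕ} (C : Controller m p) (P : Plant m p)
    (x : Vec m × Vec p) (ζ : Vec p) : Vec m :=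
  act (P.J₁ x - P.R₁ x) (gradient (fun y => C.Hc (act C.Eᵀ y - ζ)) x.1)

/-- The controller dynamics `ζ' = Eᵀ J₁₂ ∇_{x₂} H`. -/
noncomputable def Controller.field {m p : ℕ} (C : Controller m p) (P : Plant m p)
    (x : Vec m × Vec p) : Vec p :=
  act (C.Eᵀ * P.J₁₂ x) (grad₂ P.H x)

/-- Closed loop vector field, in the state `w = (x₁, x₂, ζ)`, under constant
disturbances `d₁`, `d₂`. -/
noncomputable def closedLoop {m p : ℕ} (P : Plant m p) (C : Controller m p)
    (d₁ : Vec m) (d₂ : Vec p) (w : Vec m × Vec p × Vec p) : Vec m × Vec p × Vec p :=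
  let x : Vec m × Vec p := (w.1, w.2.1)
  let v := P.field (C.input P x w.2.2) d₁ d₂ x
  (v.1, v.2, C.field P x)

/-- Closed loop Hamiltonian `Hcl = H (x₁, x₂) + Hc (Eᵀ x₁ - ζ)`. -/
noncomputable def Hcl {m p : ℕ} (P : Plant m p) (C : Controller m p)
    (w : Vec m × Vec p × Vec p) : ℝ :=
  P.H (w.1, w.2.1) + C.Hc (act C.Eᵀ w.1 - w.2.2)

/-- The gradient `(∇_{x₁} Hcl, ∇_{x₂} Hcl, ∇_ζ Hcl)` of the closed loop Hamiltonian. -/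
noncomputable def gradHcl {m p : ℕ} (P : Plant m p) (C : Controller m p)
    (w : Vec m × Vec p × Vec p) : Vec m × Vec p × Vec p :=
  (gradient (fun y => Hcl P C (y, w.2.1, w.2.2)) w.1,
   gradient (fun y => Hcl P C (w.1, y, w.2.2)) w.2.1,
   gradient (fun y => Hcl P C (w.1, w.2.1, y)) w.2.2)

/-- `w` solves the autonomous equation `w' = f w` on the time set `s`. -/
def IsSolutionOn {X : Type*} [NormedAddCommGroup X] [NormedSpace ℝ X]
    (f : X → X) (w : ℝ → X) (s : Set ℝ) : Prop :=
  IsIntegralCurveOn w (fun _ => f) s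

/-- `e` is a globally asymptotically stable equilibrium of `w' = f w`. Solutions need not
be unique for this definition; all of them are constrained. -/
structure IsGloballyAsymptoticallyStable {X : Type*} [NormedAddCommGroup X] [NormedSpace ℝ X]
    (f : X → X) (e : X) : Prop where
  /-- `e` is an equilibrium -/
  equilibrium : f e = 0
  /-- from every initial state there is a solution for all forward times -/
  exists_solution : ∀ w₀ : X, ∃ w : ℝ → X, w 0 = w₀ ∧ IsSolutionOn f w (Ici 0)
  /-- no solution escapes in finite time: each one continues to all forward times -/
  complete : ∀ (T : ℝ) (w : ℝ → X), 0 < T → IsSolutionOn f w (Ico 0 T) →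
    ∃ w' : ℝ → X, EqOn w' w (Ico 0 T) ∧ IsSolutionOn f w' (Ici 0)
  /-- Lyapunov stability -/
  stable : ∀ ε > 0, ∃ δ > 0, ∀ w : ℝ → X, IsSolutionOn f w (Ici 0) →
    ‖w 0 - e‖ < δ → ∀ t, 0 ≤ t → ‖w t - e‖ < ε
  /-- global attractivity -/
  attractive : ∀ w : ℝ → X, IsSolutionOn f w (Ici 0) → Tendsto w atTop (𝓝 e)

end PortHamiltonian

/-!
The closed loop is port-Hamiltonian with respect to `Hcl`. Write `z = Eᵀ x₁ - ζ`,
`a = ∇_{x₁} Hcl = ∇_{x₁} H + E ∇Hc z`, `g = ∇_{x₂} H`, `M = J₁₂ᵀ E` and `q = M⁻¹ d₂`. Since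
`d₂ = M q`, the disturbance only shifts `∇Hc z` to `∇Hc z - q` (`closedLoop_eq`):
`x₁' = J₁₂ g + (J₁ - R₁) a`, `x₂' = M (∇Hc z - q) - J₁₂ᵀ a + (J₂ - R₂) g`, `ζ' = Mᵀ g`.
Hence `V = Hcl + ⟪q, ζ⟫` satisfies `V' = -⟪a, R₁ a⟫ - ⟪g, R₂ g⟫ ≤ 0`
(`shiftedHclDeriv_closedLoop`). This `V` is strictly convex, and its only critical point is the point
where the gradient of `Hcl` is `(0, 0, -q)`, so that point is a strict minimum and `V` grows at least
linearly away from it (`ConvexOn.exists_linear_growth`). Stability and boundedness follow.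

The field is only continuous, because `∇Hc` is, so solutions need not be unique and the
Picard-Lindelöf theorem does not apply. Existence is Peano's theorem
(`exists_isSolutionOn_of_uniformContinuous`), applied to a cutoff of the field that does not affect
the sublevel set of `V` in question (`exists_isSolutionOn_Ici`).

Attractivity (`tendsto_of_isSolutionOn`) replaces LaSalle's principle by a form of Barbalat's lemma
that uses no uniqueness (`tendsto_zero_of_increments`): if `y' = b + r` with `b` uniformly continuous
and `r → 0`, and the increments of `y` over each fixed time lag tend to zero, then `b → 0`. With
`y = V` it gives `a → 0`. Then `z' = Eᵀ (J₁ - R₁) a → 0`, so `∇Hc z`, and with it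
`∇_{x₁} H = a - E ∇Hc z`, becomes stationary; as `H` has no cross terms and is strictly convex,
`∇_{x₁} H` determines `x₁`, so the increments of `x₁` die out. With `y = x₁` the lemma gives
`J₁₂ g → 0`, whence `g → 0` and `x₂ → x₂*`, and with `y = x₂` it gives `M (∇Hc z - q) → 0`. The
limits of `a`, `g` and `∇Hc z` determine the limit of the state (`eq_of_gradients_eq`).
-/

namespace PortHamiltonian

/-! ### Peano's theorem for bounded uniformly continuous fields -/

section Peano

variable {X : Type*} [NormedAddCommGroup X] [NormedSpace ℝ X]

/-- The explicit Euler scheme with step `h` for `w' = g w`, started at `w₀`, read as a step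
function of time: at time `t` it takes the value of the `⌊t / h⌋`-th iterate. -/
noncomputable def eulerStep (g : X → X) (w₀ : X) (h t : ℝ) : X :=
  (fun x => x + h • g x)^[⌊t / h⌋₊] w₀

lemma euler_iterate_sub_norm_le {g : X → X} {L h : ℝ} (hL : ∀ x, ‖g x‖ ≤ L) (hh : 0 ≤ h)
    (x : X) (n : ℕ) : ‖(fun x => x + h • g x)^[n] x - x‖ ≤ n * h * L := by
  induction n with
  | zero => simp
  | succ n ih =>
    rw [Function.iterate_succ_apply']
    set y := (fun x => x + h • g x)^[n] x
    calc ‖y + h • g y - x‖ = ‖(y - x) + h • g y‖ := by congr 1; abel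
      _ ≤ ‖y - x‖ + ‖h • g y‖ := norm_add_le _ _
      _ ≤ n * h * L + h * L := by
        rw [norm_smul, Real.norm_of_nonneg hh]
        gcongr
        exact hL y
      _ = _ := by push_cast; ring

lemma euler_iterate_sub_sub_norm_le {g : X → X} {L h δ ε : ℝ} (hL : ∀ x, ‖g x‖ ≤ L) (hh : 0 ≤ h)
    (hδ : ∀ x y, ‖x - y‖ < δ → ‖g x - g y‖ ≤ ε) (x : X) (n : ℕ) (hn : n * h * L < δ) :
    ‖(fun x => x + h • g x)^[n] x - x - (n * h) • g x‖ ≤ n * h * ε := by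
  have hL0 : 0 ≤ L := (norm_nonneg _).trans (hL x)
  induction n with
  | zero => simp
  | succ n ih =>
    have hn' : n * h * L < δ := by
      refine lt_of_le_of_lt ?_ hn
      gcongr
      simp
    rw [Function.iterate_succ_apply']
    have h1 := euler_iterate_sub_norm_le hL hh x n
    have ih := ih hn'
    set y := (fun x => x + h • g x)^[n] x
    have h2 : ‖g y - g x‖ ≤ ε := hδ _ _ (h1.trans_lt hn')
    calc ‖y + h • g y - x - ((n + 1 : ℕ) * h) • g x‖
        = ‖(y - x - (n * h) • g x) + h • (g y - g x)‖ := by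
          congr 1; push_cast; module
      _ ≤ ‖y - x - (n * h) • g x‖ + ‖h • (g y - g x)‖ := norm_add_le _ _
      _ ≤ n * h * ε + h * ε := by
        rw [norm_smul, Real.norm_of_nonneg hh]
        gcongr
      _ = _ := by push_cast; ring

/-- The Euler step functions solve the equation up to an error of the order of the step,
uniformly on short time intervals. -/
lemma eulerStep_sub_sub_norm_le {g : X → X} {L h δ ε : ℝ} (hL : ∀ x, ‖g x‖ ≤ L) (hh : 0 < h)
    (hε : 0 ≤ ε) (hδ : ∀ x y, ‖x - y‖ < δ → ‖g x - g y‖ ≤ ε) (w₀ : X) {s t : ℝ} (hs : 0 ≤ s)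
    (hst : s ≤ t) (hlt : (t - s + h) * L < δ) :
    ‖eulerStep g w₀ h t - eulerStep g w₀ h s - (t - s) • g (eulerStep g w₀ h s)‖
      ≤ (t - s + h) * ε + h * L := by
  have hL0 : 0 ≤ L := (norm_nonneg _).trans (hL w₀)
  obtain ⟨n, hn⟩ := Nat.exists_eq_add_of_le (Nat.floor_mono (div_le_div_of_nonneg_right hst hh.le))
  have es1 := Nat.floor_le (div_nonneg hs hh.le)
  have es2 := Nat.lt_floor_add_one (s / h)
  have et1 := Nat.floor_le (div_nonneg (hs.trans hst) hh.le)
  have et2 := Nat.lt_floor_add_one (t / h)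
  rw [le_div_iff₀ hh] at es1 et1
  rw [div_lt_iff₀ hh] at es2 et2
  rw [hn] at et1 et2
  push_cast at et1 et2
  have hnle : n * h ≤ t - s + h := by linarith
  have hnabs : |n * h - (t - s)| ≤ h := by rw [abs_le]; constructor <;> linarith
  have key := euler_iterate_sub_sub_norm_le hL hh.le hδ (eulerStep g w₀ h s) n
    ((mul_le_mul_of_nonneg_right hnle hL0).trans_lt hlt)
  have hx : eulerStep g w₀ h t = (fun x => x + h • g x)^[n] (eulerStep g w₀ h s) := by
    rw [eulerStep, eulerStep, hn, add_comm, Function.iterate_add_apply]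
  rw [← hx] at key
  set y := eulerStep g w₀ h s
  calc ‖eulerStep g w₀ h t - y - (t - s) • g y‖
      = ‖(eulerStep g w₀ h t - y - (n * h) • g y) + (n * h - (t - s)) • g y‖ := by
        congr 1; module
    _ ≤ n * h * ε + |n * h - (t - s)| * ‖g y‖ := by
        refine (norm_add_le _ _).trans ?_
        rw [norm_smul, Real.norm_eq_abs]
        gcongr
    _ ≤ (t - s + h) * ε + h * L := by
        gcongr
        exact hL y

lemma eulerStep_sub_norm_le {g : X → X} {L h : ℝ} (hL : ∀ x, ‖g x‖ ≤ L) (hh : 0 < h)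
    (w₀ : X) (t : ℝ) : ‖eulerStep g w₀ h t - w₀‖ ≤ |t| * L := by
  have hL0 : 0 ≤ L := (norm_nonneg _).trans (hL w₀)
  refine (euler_iterate_sub_norm_le hL hh.le w₀ _).trans ?_
  gcongr
  rcases le_or_gt 0 t with ht | ht
  · have := Nat.floor_le (div_nonneg ht hh.le)
    rw [le_div_iff₀ hh] at this
    exact this.trans (le_abs_self t)
  · rw [Nat.floor_of_nonpos (div_nonpos_of_nonpos_of_nonneg ht.le hh.le)]
    simp

/-- Peano's theorem for bounded uniformly continuous fields. The solution is a pointwise limit of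
Euler step functions along an ultrafilter, which needs no equicontinuity: the differential
equation passes to the limit in its integrated form. -/
theorem exists_isSolutionOn_of_uniformContinuous [ProperSpace X] {g : X → X} {L : ℝ}
    (hg : UniformContinuous g) (hL : ∀ x, ‖g x‖ ≤ L) (w₀ : X) :
    ∃ w : ℝ → X, w 0 = w₀ ∧ IsSolutionOn g w (Ici 0) := by
  have hL0 : 0 ≤ L := (norm_nonneg _).trans (hL w₀)
  let h : ℕ → ℝ := fun N => 1 / ((N : ℝ) + 1)
  have hpos : ∀ N, 0 < h N := fun N => Nat.one_div_pos_of_nat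
  let U : Ultrafilter ℕ := hyperfilter ℕ
  have hU : Tendsto h U (𝓝 0) :=
    tendsto_one_div_add_atTop_nhds_zero_nat.mono_left Nat.hyperfilter_le_atTop
  have hlim : ∀ t, ∃ x, Tendsto (fun N => eulerStep g w₀ (h N) t) U (𝓝 x) := by
    intro t
    obtain ⟨x, -, hx⟩ := (isCompact_closedBall w₀ (|t| * L)).ultrafilter_le_nhds'
      (U.map fun N => eulerStep g w₀ (h N) t)
      (Filter.mem_map.2 <| Filter.Eventually.of_forall fun N => by
        rw [mem_closedBall_iff_norm]
        exact eulerStep_sub_norm_le hL (hpos N) w₀ t)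
    exact ⟨x, hx⟩
  choose w hw using hlim
  have w0 : w 0 = w₀ := by
    refine tendsto_nhds_unique (hw 0) ?_
    simp [eulerStep]
  -- The integrated form of the equation, which gives the derivative from the right at `s`.
  have hquot : ∀ ε δ : ℝ, 0 ≤ ε → (∀ x y, ‖x - y‖ < δ → ‖g x - g y‖ ≤ ε) → ∀ s t, 0 ≤ s → s ≤ t →
      (t - s) * L < δ → ‖w t - w s - (t - s) • g (w s)‖ ≤ (t - s) * ε := by
    intro ε δ hε hδ s t hs hst hlt
    have h1 : Tendsto (fun N => ‖eulerStep g w₀ (h N) t - eulerStep g w₀ (h N) s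
        - (t - s) • g (eulerStep g w₀ (h N) s)‖) U (𝓝 ‖w t - w s - (t - s) • g (w s)‖) :=
      (((hw t).sub (hw s)).sub (((hg.continuous.tendsto _).comp (hw s)).const_smul _)).norm
    have h2 : Tendsto (fun N => (t - s + h N) * ε + h N * L) U (𝓝 ((t - s + 0) * ε + 0 * L)) :=
      ((tendsto_const_nhds.add hU).mul_const _).add (hU.mul_const _)
    have h3 : Tendsto (fun N => (t - s + h N) * L) U (𝓝 ((t - s + 0) * L)) :=
      (tendsto_const_nhds.add hU).mul_const _
    have h4 := le_of_tendsto_of_tendsto h1 h2 (by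
      filter_upwards [h3.eventually_lt_const (by simpa using hlt : _ < δ)] with N hN
      exact eulerStep_sub_sub_norm_le hL (hpos N) hε hδ w₀ hs hst hN)
    simpa using h4
  have hlip : ∀ s t, 0 ≤ s → s ≤ t → ‖w t - w s‖ ≤ (t - s) * (3 * L) := by
    intro s t hs hst
    have h1 := hquot (2 * L) ((t - s) * L + 1) (by positivity) (fun x y _ => by
      linarith [norm_sub_le (g x) (g y), hL x, hL y]) s t hs hst (by linarith)
    have h2 : ‖(t - s) • g (w s)‖ ≤ (t - s) * L := by
      rw [norm_smul, Real.norm_of_nonneg (sub_nonneg.2 hst)]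
      exact mul_le_mul_of_nonneg_left (hL _) (sub_nonneg.2 hst)
    have h3 := norm_le_norm_sub_add (w t - w s) ((t - s) • g (w s))
    linarith
  refine ⟨w, w0, fun s hs => ?_⟩
  rw [hasDerivWithinAt_iff_isLittleO, Asymptotics.isLittleO_iff]
  intro c hc
  obtain ⟨δ, hδ0, hδ⟩ := Metric.uniformContinuous_iff_le.1 hg (c / 2) (half_pos hc)
  have hδ' : ∀ x y, ‖x - y‖ < δ → ‖g x - g y‖ ≤ c / 2 := fun x y hxy => by
    simpa [dist_eq_norm] using hδ (by rw [dist_eq_norm]; exact hxy.le)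
  have hnear : ∀ᶠ t in 𝓝 s, |t - s| * (3 * L) < δ := by
    have : Continuous fun t : ℝ => |t - s| * (3 * L) := by fun_prop
    exact (this.tendsto s).eventually_lt_const (by simpa using hδ0)
  filter_upwards [self_mem_nhdsWithin, nhdsWithin_le_nhds hnear] with t ht hts
  rcases le_total s t with hst | hst
  · rw [Real.norm_of_nonneg (sub_nonneg.2 hst)]
    rw [abs_of_nonneg (sub_nonneg.2 hst)] at hts
    have h0 : 0 ≤ (t - s) * L := mul_nonneg (sub_nonneg.2 hst) hL0
    have h0' : 0 ≤ (t - s) * c := mul_nonneg (sub_nonneg.2 hst) hc.le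
    have := hquot _ δ (half_pos hc).le hδ' s t hs hst (by linarith)
    linarith
  -- For `t < s` the estimate is based at `t`; passing from `g (w t)` to `g (w s)` costs `c / 2`.
  · rw [abs_sub_comm, abs_of_nonneg (sub_nonneg.2 hst)] at hts
    have h0 : 0 ≤ (s - t) * L := mul_nonneg (sub_nonneg.2 hst) hL0
    have h1 := hquot _ δ (half_pos hc).le hδ' t s ht hst (by linarith)
    have h2 := hδ' (w s) (w t) ((hlip t s ht hst).trans_lt hts)
    rw [Real.norm_of_nonpos (sub_nonpos.2 hst)]
    calc ‖w t - w s - (t - s) • g (w s)‖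
        = ‖-((w s - w t - (s - t) • g (w t)) - (s - t) • (g (w s) - g (w t)))‖ := by
          congr 1; module
      _ ≤ (s - t) * (c / 2) + (s - t) * (c / 2) := by
          rw [norm_neg]
          refine (norm_sub_le _ _).trans (add_le_add h1 ?_)
          rw [norm_smul, Real.norm_of_nonneg (sub_nonneg.2 hst)]
          exact mul_le_mul_of_nonneg_left h2 (sub_nonneg.2 hst)
      _ = c * -(t - s) := by ring

end Peano

/-! ### Asymptotics of curves in compact sets, and Barbalat's lemma -/

section Asymptotics

variable {X Y : Type*}

/-- Along a curve in a compact set, if one continuous map approaches a value that forces the value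
of another, the other approaches that value. -/
lemma tendsto_of_isCompact [TopologicalSpace X] [TopologicalSpace Y] [T2Space Y] {Z : Type*}
    [TopologicalSpace Z] {K : Set X} (hK : IsCompact K) {ι : Type*} {l : Filter ι} {u : ι → X}
    (hu : ∀ᶠ t in l, u t ∈ K) {φ : X → Y} (hφ : Continuous φ) {ψ : X → Z} (hψ : Continuous ψ)
    {y : Y} {z : Z} (hyz : ∀ x, φ x = y → ψ x = z) (h : Tendsto (fun t => φ (u t)) l (𝓝 y)) :
    Tendsto (fun t => ψ (u t)) l (𝓝 z) := by
  rw [tendsto_iff_ultrafilter]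
  intro U hU
  obtain ⟨a, -, ha⟩ := hK.ultrafilter_le_nhds' (U.map u) (hU hu)
  have ha' : Tendsto u U (𝓝 a) := ha
  rw [← hyz a (tendsto_nhds_unique ((hφ.tendsto a).comp ha') (h.mono_left hU))]
  exact (hψ.tendsto a).comp ha'

/-- A form of Barbalat's lemma: if the increments of `y` over every fixed time lag die out, and
`y' = b + r` with `b` uniformly continuous and `r → 0`, then `b → 0`. -/
theorem tendsto_zero_of_increments [NormedAddCommGroup Y] [NormedSpace ℝ Y] {y b r : ℝ → Y}
    (hy : ∀ t, 0 ≤ t → HasDerivWithinAt y (b t + r t) (Ici 0) t)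
    (hb : UniformContinuousOn b (Ici 0)) (hr : Tendsto r atTop (𝓝 0))
    (hinc : ∀ h, 0 < h → Tendsto (fun t => y (t + h) - y t) atTop (𝓝 0)) :
    Tendsto b atTop (𝓝 0) := by
  rw [Metric.tendsto_atTop]
  intro ε hε
  obtain ⟨δ, hδ, hbδ⟩ := Metric.uniformContinuousOn_iff.1 hb (ε / 4) (by positivity)
  have hh : 0 < δ / 2 := half_pos hδ
  obtain ⟨T₁, hT₁⟩ := Metric.tendsto_atTop.1 hr (ε / 4) (by positivity)
  obtain ⟨T₂, hT₂⟩ := Metric.tendsto_atTop.1 (hinc _ hh) (δ / 2 * (ε / 4)) (by positivity)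
  refine ⟨max 0 (max T₁ T₂), fun t ht => ?_⟩
  have ht0 : 0 ≤ t := (le_max_left _ _).trans ht
  have ht1 : T₁ ≤ t := (le_max_left _ _).trans ((le_max_right _ _).trans ht)
  have ht2 : T₂ ≤ t := (le_max_right _ _).trans ((le_max_right _ _).trans ht)
  -- The mean value inequality for `s ↦ y s - s • b t`, on an interval where `b` is almost constant.
  have hmv := norm_image_sub_le_of_norm_deriv_le_segment' (f := fun s => y s - s • b t)
    (f' := fun s => b s + r s - b t) (a := t) (b := t + δ / 2) (C := ε / 4 + ε / 4)
    (fun s hs => by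
      have h1 := (hy s (ht0.trans hs.1)).mono (fun x hx => ht0.trans hx.1 : Icc t (t + δ / 2) ⊆ _)
      have h2 := ((hasDerivAt_id s).smul_const (b t)).hasDerivWithinAt (s := Icc t (t + δ / 2))
      rw [one_smul] at h2
      exact h1.sub h2)
    (fun s hs => by
      have h1 := hbδ s (ht0.trans hs.1) t ht0 (by
        rw [Real.dist_eq, abs_of_nonneg (sub_nonneg.2 hs.1)]; linarith [hs.2])
      have h2 := hT₁ s (ht1.trans hs.1)
      rw [dist_eq_norm] at h1
      rw [dist_zero_right] at h2
      calc ‖b s + r s - b t‖ = ‖(b s - b t) + r s‖ := by congr 1; abel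
        _ ≤ _ := (norm_add_le _ _).trans (add_le_add h1.le h2.le))
    (t + δ / 2) (right_mem_Icc.2 (by linarith))
  have h3 := hT₂ t ht2
  rw [dist_zero_right] at h3 ⊢
  have h4 : ‖(δ / 2) • b t‖ ≤ ‖y (t + δ / 2) - y t‖
      + ‖y (t + δ / 2) - (t + δ / 2) • b t - (y t - t • b t)‖ := by
    refine le_trans (le_of_eq ?_) (norm_sub_le _ _)
    congr 1; module
  rw [norm_smul, Real.norm_of_nonneg hh.le] at h4
  have h5 : δ / 2 * ‖b t‖ < δ / 2 * ε := by nlinarith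
  exact lt_of_mul_lt_mul_left h5 hh.le

/-- If `y' → 0`, the increments of `y` over a fixed time lag die out. -/
lemma increments_tendsto_zero [NormedAddCommGroup Y] [NormedSpace ℝ Y] {y r : ℝ → Y}
    (hy : ∀ t, 0 ≤ t → HasDerivWithinAt y (r t) (Ici 0) t) (hr : Tendsto r atTop (𝓝 0)) {h : ℝ}
    (hh : 0 < h) : Tendsto (fun t => y (t + h) - y t) atTop (𝓝 0) := by
  rw [Metric.tendsto_atTop]
  intro ε hε
  obtain ⟨T, hT⟩ := Metric.tendsto_atTop.1 hr (ε / (2 * h)) (by positivity)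
  refine ⟨max 0 T, fun t ht => ?_⟩
  have ht0 : 0 ≤ t := (le_max_left _ _).trans ht
  have ht1 : T ≤ t := (le_max_right _ _).trans ht
  have hmv := norm_image_sub_le_of_norm_deriv_le_segment' (f := y) (f' := r) (a := t) (b := t + h)
    (C := ε / (2 * h)) (fun s hs => (hy s (ht0.trans hs.1)).mono fun x hx => ht0.trans hx.1)
    (fun s hs => by simpa using (hT s (ht1.trans hs.1)).le) (t + h) (right_mem_Icc.2 (by linarith))
  rw [dist_zero_right]
  refine hmv.trans_lt ?_
  rw [add_sub_cancel_left]
  field_simp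
  linarith

lemma increments_tendsto_zero_of_tendsto [NormedAddCommGroup Y] {y : ℝ → Y} {c : Y}
    (hy : Tendsto y atTop (𝓝 c)) (h : ℝ) : Tendsto (fun t => y (t + h) - y t) atTop (𝓝 0) := by
  simpa using (hy.comp (tendsto_atTop_add_const_right _ h tendsto_id)).sub hy

end Asymptotics

/-! ### Strictly convex functions: first-order conditions and growth -/

section Convexity

variable {X : Type*} [NormedAddCommGroup X] [NormedSpace ℝ X]

/-- A strictly convex function lies strictly above its tangents. -/
lemma _root_.StrictConvexOn.add_fderiv_lt {V : X → ℝ} (hV : StrictConvexOn ℝ univ V)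
    {V' : X →L[ℝ] ℝ} {x y : X} (hx : HasFDerivAt V V' x) (hxy : y ≠ x) : V x + V' (y - x) < V y := by
  have hline : StrictConvexOn ℝ univ (fun t : ℝ => V (AffineMap.lineMap x y t)) := by
    refine ⟨convex_univ, fun s _ t _ hst a b ha hb hab => ?_⟩
    have hne : (AffineMap.lineMap x y s : X) ≠ AffineMap.lineMap x y t :=
      fun h => hst (AffineMap.lineMap_injective ℝ hxy.symm h)
    have := hV.2 (mem_univ _) (mem_univ _) hne ha hb hab
    rwa [← Convex.combo_affine_apply hab] at this
  have hd : HasDerivAt (fun t : ℝ => V (AffineMap.lineMap x y t)) (V' (y - x)) 0 := by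
    have h1 : HasDerivAt (fun t : ℝ => (AffineMap.lineMap x y t : X)) (y - x) 0 :=
      AffineMap.hasDerivAt_lineMap
    exact HasFDerivAt.comp_hasDerivAt (0 : ℝ) (by simpa using hx) h1
  have := hline.lt_slope_of_hasDerivAt (mem_univ 0) (mem_univ 1) zero_lt_one hd
  rw [slope_def_field] at this
  simp only [AffineMap.lineMap_apply_zero, AffineMap.lineMap_apply_one, sub_zero, div_one] at this
  linarith

/-- The derivative of a strictly convex function is injective. -/
lemma _root_.StrictConvexOn.eq_of_hasFDerivAt {V : X → ℝ} (hV : StrictConvexOn ℝ univ V)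
    {V' : X →L[ℝ] ℝ} {x y : X} (hx : HasFDerivAt V V' x) (hy : HasFDerivAt V V' y) : x = y := by
  by_contra hne
  have h1 := hV.add_fderiv_lt hx (Ne.symm hne)
  have h2 := hV.add_fderiv_lt hy hne
  rw [← neg_sub, map_neg] at h2
  linarith

/-- A continuous convex function on a finite-dimensional space with a strict minimum grows at
least linearly away from it: compare with its minimum on a small sphere. -/
lemma _root_.ConvexOn.exists_linear_growth [ProperSpace X] {V : X → ℝ} (hV : ConvexOn ℝ univ V)
    (hcont : Continuous V) {e : X} (hmin : ∀ w, w ≠ e → V e < V w) {ε : ℝ} (hε : 0 < ε) :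
    ∃ μ > 0, ∀ w, ε ≤ ‖w - e‖ → V e + μ * ‖w - e‖ ≤ V w := by
  -- The sphere is empty only in the trivial space, where the claim is vacuous.
  rcases (Metric.sphere e ε).eq_empty_or_nonempty with hemp | hne
  · refine ⟨1, one_pos, fun w hw => ?_⟩
    have hw0 : 0 < ‖w - e‖ := hε.trans_le hw
    have : e + (ε / ‖w - e‖) • (w - e) ∈ Metric.sphere e ε := by
      rw [mem_sphere_iff_norm, add_sub_cancel_left, norm_smul, norm_div, norm_norm,
        Real.norm_of_nonneg hε.le, div_mul_cancel₀ _ hw0.ne']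
    simp [hemp] at this
  · obtain ⟨s, hs, hsmin⟩ := (isCompact_sphere e ε).exists_isMinOn hne hcont.continuousOn
    have hse : s ≠ e := by
      rintro rfl
      simp at hs
      exact hε.ne hs
    have hpos : 0 < V s - V e := sub_pos.2 (hmin s hse)
    refine ⟨(V s - V e) / ε, div_pos hpos hε, fun w hw => ?_⟩
    have hw0 : 0 < ‖w - e‖ := hε.trans_le hw
    set c := ε / ‖w - e‖ with hc
    have hc0 : 0 < c := div_pos hε hw0
    have hc1 : c ≤ 1 := (div_le_one hw0).2 hw
    have hmem : c • w + (1 - c) • e ∈ Metric.sphere e ε := by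
      have : c • w + (1 - c) • e - e = c • (w - e) := by module
      rw [mem_sphere_iff_norm, this, norm_smul, Real.norm_of_nonneg hc0.le, hc,
        div_mul_cancel₀ _ hw0.ne']
    have h1 : V s ≤ V (c • w + (1 - c) • e) := hsmin hmem
    have h2 := hV.2 (mem_univ w) (mem_univ e) hc0.le (sub_nonneg.2 hc1) (by ring)
    simp only [smul_eq_mul] at h2
    have h3 : V s - V e ≤ c * (V w - V e) := by linarith
    rw [hc, div_mul_eq_mul_div, le_div_iff₀ hw0] at h3
    rw [div_mul_eq_mul_div, ← le_sub_iff_add_le', div_le_iff₀ hε]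
    linarith

end Convexity

lemma isCompact_sublevel_of_linear_growth {X : Type*} [NormedAddCommGroup X] [ProperSpace X]
    {V : X → ℝ} (hV : Continuous V) {e : X} {μ : ℝ} (hμ : 0 < μ)
    (hgrow : ∀ w, 1 ≤ ‖w - e‖ → V e + μ * ‖w - e‖ ≤ V w) (c : ℝ) :
    IsCompact {x | V x ≤ c} := by
  refine Metric.isCompact_of_isClosed_isBounded (isClosed_le hV continuous_const) ?_
  refine (Metric.isBounded_closedBall (x := e) (r := max 1 ((c - V e) / μ))).subset fun w hw => ?_
  rw [mem_closedBall_iff_norm, le_max_iff]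
  rcases le_total ‖w - e‖ 1 with h | h
  · exact Or.inl h
  · right
    rw [le_div_iff₀ hμ]
    have hwc : V w ≤ c := hw
    linarith [hgrow w h]

/-! ### Lyapunov theory for continuous fields -/

section Lyapunov

variable {X : Type*} [NormedAddCommGroup X] [NormedSpace ℝ X] {f : X → X} {V : X → ℝ}
  {V' : X → X →L[ℝ] ℝ}

lemma IsSolutionOn.antitoneOn {w : ℝ → X} {s : Set ℝ} (hw : IsSolutionOn f w s)
    (hs : Convex ℝ s) (hV : ∀ x, HasFDerivAt V (V' x) x) (hdec : ∀ x, V' x (f x) ≤ 0) :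
    AntitoneOn (fun t => V (w t)) s := by
  refine antitoneOn_of_hasDerivWithinAt_nonpos hs (f' := fun t => V' (w t) (f (w t)))
    (fun t ht => ?_) (fun t ht => ?_) (fun t _ => hdec _)
  · exact ((hV (w t)).comp_hasDerivWithinAt t (hw t ht)).continuousWithinAt
  · exact (hV (w t)).comp_hasDerivWithinAt t ((hw t (interior_subset ht)).mono interior_subset)

lemma IsSolutionOn.exists_lipschitzOnWith (hf : Continuous f) {K : Set X} (hK : IsCompact K)
    {w : ℝ → X} {s : Set ℝ} (hs : Convex ℝ s) (hw : IsSolutionOn f w s) (hwK : ∀ t ∈ s, w t ∈ K) :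
    ∃ B, LipschitzOnWith B w s := by
  obtain ⟨B, hB⟩ := hK.exists_bound_of_continuousOn hf.continuousOn
  refine ⟨B.toNNReal, hs.lipschitzOnWith_of_nnnorm_hasDerivWithin_le hw fun t ht => ?_⟩
  rw [← NNReal.coe_le_coe, coe_nnnorm]
  exact (hB _ (hwK t ht)).trans (Real.le_coe_toNNReal B)

lemma IsSolutionOn.uniformContinuousOn_comp {Y : Type*} [NormedAddCommGroup Y]
    (hf : Continuous f) {K : Set X} (hK : IsCompact K) {w : ℝ → X}
    (hw : IsSolutionOn f w (Ici 0)) (hwK : ∀ t ∈ Ici (0 : ℝ), w t ∈ K) {φ : X → Y}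
    (hφ : Continuous φ) : UniformContinuousOn (fun t => φ (w t)) (Ici 0) := by
  obtain ⟨B, hlip⟩ := hw.exists_lipschitzOnWith hf hK (convex_Ici 0) hwK
  exact (hK.uniformContinuousOn_of_continuous hφ.continuousOn).comp hlip.uniformContinuousOn hwK

/-- Forward existence for a merely continuous field with a proper Lyapunov function. The field is
multiplied by a cutoff between `0` and `1` that equals `1` on the initial sublevel set of `V`: the
truncated field still decreases `V`, so its solutions never leave that set. -/
theorem exists_isSolutionOn_Ici [ProperSpace X] (hf : Continuous f)
    (hV : ∀ x, HasFDerivAt V (V' x) x) (hdec : ∀ x, V' x (f x) ≤ 0)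
    (hK : ∀ c, IsCompact {x | V x ≤ c}) (w₀ : X) :
    ∃ w : ℝ → X, w 0 = w₀ ∧ IsSolutionOn f w (Ici 0) := by
  have hVc : Continuous V := continuous_iff_continuousAt.2 fun x => (hV x).continuousAt
  let χ : X → ℝ := fun x => max 0 (min 1 (1 + V w₀ - V x))
  let g : X → X := fun x => χ x • f x
  have hg : Continuous g := by fun_prop
  have hsupp : HasCompactSupport g := by
    refine HasCompactSupport.intro (hK (V w₀ + 1)) fun x hx => ?_
    have : χ x = 0 := by
      simp only [mem_ofPred_eq, not_le] at hx
      refine max_eq_left ((min_le_right _ _).trans ?_)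
      linarith
    simp [g, this]
  obtain ⟨L, hL⟩ := hg.bounded_above_of_compact_support hsupp
  obtain ⟨w, hw0, hw⟩ := exists_isSolutionOn_of_uniformContinuous
    (hsupp.uniformContinuous_of_continuous hg) hL w₀
  have hanti := hw.antitoneOn (convex_Ici 0) hV fun x => by
    simpa [g] using mul_nonpos_of_nonneg_of_nonpos (le_max_left _ _ : 0 ≤ χ x) (hdec x)
  refine ⟨w, hw0, fun t ht => ?_⟩
  have hle : V (w t) ≤ V w₀ := by
    simpa [hw0] using hanti self_mem_Ici ht ht
  have hχ : χ (w t) = 1 := by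
    simp only [χ]
    rw [min_eq_left (by linarith), max_eq_right zero_le_one]
  simpa [g, hχ] using hw t ht

/-- Two solutions that match at time `T` concatenate to a solution. -/
lemma IsSolutionOn.concat {u v : ℝ → X} {T : ℝ} (hT : 0 < T) (hu : IsSolutionOn f u (Icc 0 T))
    (hv : IsSolutionOn f v (Ici 0)) (huv : v 0 = u T) :
    IsSolutionOn f (fun t => if t ≤ T then u t else v (t - T)) (Ici 0) := by
  set w : ℝ → X := fun t => if t ≤ T then u t else v (t - T) with hw
  have hwu : EqOn w u (Iic T) := fun t ht => if_pos ht
  have hwv : EqOn w (fun t => v (t - T)) (Ici T) := by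
    intro t ht
    rcases (mem_Ici.1 ht).eq_or_lt with rfl | h
    · simp [hw, huv]
    · exact if_neg (not_le.2 h)
  have hleft : ∀ t ∈ Icc 0 T, HasDerivWithinAt w (f (w t)) (Icc 0 T) t := by
    intro t ht
    rw [hwu ht.2]
    exact (hu t ht).congr (fun s hs => hwu hs.2) (hwu ht.2)
  have hright : ∀ t ∈ Ici T, HasDerivWithinAt w (f (w t)) (Ici T) t := by
    intro t ht
    have h1 : HasDerivWithinAt (fun s : ℝ => s - T) 1 (Ici T) t :=
      ((hasDerivAt_id t).sub_const T).hasDerivWithinAt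
    have h2 := (hv (t - T) (mem_Ici.2 (sub_nonneg.2 ht))).scomp t h1
      (fun s hs => mem_Ici.2 (sub_nonneg.2 hs))
    rw [one_smul] at h2
    rw [hwv ht]
    exact h2.congr hwv (hwv ht)
  intro t ht
  rcases lt_trichotomy t T with h | rfl | h
  · refine (hleft t ⟨ht, h.le⟩).mono_of_mem_nhdsWithin ?_
    rw [← Ici_inter_Iic]
    exact inter_mem_nhdsWithin _ (Iic_mem_nhds h)
  · exact ((hleft t ⟨ht, le_rfl⟩).union (hright t self_mem_Ici)).mono fun s hs =>
      (le_total s t).imp (fun h => ⟨hs, h⟩) id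
  · refine (hright t h.le).mono_of_mem_nhdsWithin ?_
    exact mem_nhdsWithin_of_mem_nhds (Ici_mem_nhds h)

/-- A solution on `[0, T)` that stays in a compact set has a limit at `T`, and the extended curve
is a solution on `[0, T]`. -/
lemma IsSolutionOn.exists_extend_Icc [FiniteDimensional ℝ X] (hf : Continuous f) {K : Set X}
    (hK : IsCompact K) {w : ℝ → X} {T : ℝ} (hT : 0 < T) (hw : IsSolutionOn f w (Ico 0 T))
    (hwK : ∀ t ∈ Ico 0 T, w t ∈ K) :
    ∃ u : ℝ → X, EqOn u w (Ico 0 T) ∧ IsSolutionOn f u (Icc 0 T) := by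
  obtain ⟨B, hlip⟩ := hw.exists_lipschitzOnWith hf hK (convex_Ico 0 T) hwK
  obtain ⟨u, hu, hwu⟩ := hlip.extend_finite_dimension
  have huc : Continuous u := hu.continuous
  have hd : ∀ t ∈ Ico 0 T, HasDerivWithinAt u (f (u t)) (Ico 0 T) t := fun t ht => by
    rw [← hwu ht]
    exact (hw t ht).congr (fun s hs => (hwu hs).symm) (hwu ht).symm
  have hd' : ∀ t ∈ Ioo 0 T, HasDerivAt u (f (u t)) t := fun t ht =>
    (hd t ⟨ht.1.le, ht.2⟩).hasDerivAt (Ico_mem_nhds ht.1 ht.2)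
  refine ⟨u, fun t ht => (hwu ht).symm, fun t ht => ?_⟩
  rcases ht.2.eq_or_lt with rfl | h
  · refine (hasDerivWithinAt_Iic_of_tendsto_deriv (s := Ioo 0 t)
      (fun s hs => (hd' s hs).differentiableAt.differentiableWithinAt) huc.continuousWithinAt
      (Ioo_mem_nhdsLT hT) ?_).mono fun s hs => hs.2
    refine Tendsto.congr' ?_ (((hf.comp huc).tendsto t).mono_left nhdsWithin_le_nhds)
    filter_upwards [Ioo_mem_nhdsLT hT] with s hs
    exact (hd' s hs).deriv.symm
  · refine (hd t ⟨ht.1, h⟩).mono_of_mem_nhdsWithin ?_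
    filter_upwards [self_mem_nhdsWithin, mem_nhdsWithin_of_mem_nhds (Iio_mem_nhds h)] with s hs hs'
    exact ⟨hs.1, hs'⟩

/-- Lyapunov's theorem for a continuous field, with attractivity as a hypothesis. -/
theorem IsGloballyAsymptoticallyStable.of_lyapunov [FiniteDimensional ℝ X] (hf : Continuous f)
    (hV : ∀ x, HasFDerivAt V (V' x) x) (hdec : ∀ x, V' x (f x) ≤ 0) {e : X} (he : f e = 0)
    (hgrow : ∀ ε > 0, ∃ μ > 0, ∀ w, ε ≤ ‖w - e‖ → V e + μ * ‖w - e‖ ≤ V w)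
    (hattr : ∀ w : ℝ → X, IsSolutionOn f w (Ici 0) → Tendsto w atTop (𝓝 e)) :
    IsGloballyAsymptoticallyStable f e := by
  have : ProperSpace X := FiniteDimensional.proper ℝ X
  have hVc : Continuous V := continuous_iff_continuousAt.2 fun x => (hV x).continuousAt
  have hK : ∀ c, IsCompact {x | V x ≤ c} := by
    obtain ⟨μ, hμ, h⟩ := hgrow 1 one_pos
    exact isCompact_sublevel_of_linear_growth hVc hμ h
  refine ⟨he, exists_isSolutionOn_Ici hf hV hdec hK, fun T w hT hw => ?_, fun ε hε => ?_, hattr⟩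
  · have hanti := hw.antitoneOn (convex_Ico 0 T) hV hdec
    obtain ⟨u, huw, hu⟩ := hw.exists_extend_Icc hf (hK (V (w 0))) hT
      fun t ht => hanti ⟨le_rfl, hT⟩ ht ht.1
    obtain ⟨v, hv0, hv⟩ := exists_isSolutionOn_Ici hf hV hdec hK (u T)
    exact ⟨_, fun t ht => (if_pos ht.2.le).trans (huw ht), hu.concat hT hv hv0⟩
  · obtain ⟨μ, hμ, h⟩ := hgrow ε hε
    obtain ⟨δ, hδ, hδV⟩ := Metric.continuous_iff.1 hVc e (μ * ε) (mul_pos hμ hε)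
    refine ⟨δ, hδ, fun w hw hw0 t ht => ?_⟩
    by_contra! hfar
    have h1 := hδV (w 0) (by rwa [dist_eq_norm])
    have h2 := hw.antitoneOn (convex_Ici 0) hV hdec self_mem_Ici ht ht
    have h3 := h _ hfar
    have h4 := mul_le_mul_of_nonneg_left hfar hμ.le
    rw [Real.dist_eq] at h1
    have h5 := (le_abs_self _).trans_lt h1
    simp only at h2
    linarith

end Lyapunov

/-! ### Matrices acting on Euclidean vectors -/

section Act

variable {a b c : ℕ}

lemma act_add (A : Matrix (Fin a) (Fin b) ℝ) (v w : Vec b) :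
    act A (v + w) = act A v + act A w := by
  simp [act, mulVec_add]

lemma act_smul (A : Matrix (Fin a) (Fin b) ℝ) (r : ℝ) (v : Vec b) :
    act A (r • v) = r • act A v := by
  simp [act, mulVec_smul]

lemma act_zero (A : Matrix (Fin a) (Fin b) ℝ) : act A 0 = 0 := by
  simp [act]

/-- The action of a fixed matrix as a continuous linear map. -/
noncomputable def actCLM (A : Matrix (Fin a) (Fin b) ℝ) : Vec b →L[ℝ] Vec a :=
  LinearMap.toContinuousLinearMap
    { toFun := act A, map_add' := act_add A, map_smul' := act_smul A }

lemma actCLM_apply (A : Matrix (Fin a) (Fin b) ℝ) (v : Vec b) : actCLM A v = act A v := rfl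

lemma act_neg (A : Matrix (Fin a) (Fin b) ℝ) (v : Vec b) : act A (-v) = -act A v :=
  map_neg (actCLM A) v

lemma act_sub (A : Matrix (Fin a) (Fin b) ℝ) (v w : Vec b) :
    act A (v - w) = act A v - act A w :=
  map_sub (actCLM A) v w

lemma sub_act (A B : Matrix (Fin a) (Fin b) ℝ) (v : Vec b) :
    act (A - B) v = act A v - act B v := by
  simp [act, sub_mulVec]

lemma neg_act (A : Matrix (Fin a) (Fin b) ℝ) (v : Vec b) : act (-A) v = -act A v := by
  simp [act, neg_mulVec]

lemma mul_act (A : Matrix (Fin a) (Fin b) ℝ) (B : Matrix (Fin b) (Fin c) ℝ) (v : Vec c) :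
    act (A * B) v = act A (act B v) := by
  simp [act, mulVec_mulVec]

lemma one_act (v : Vec a) : act (1 : Matrix (Fin a) (Fin a) ℝ) v = v := by
  simp [act]

lemma act_injective {A : Matrix (Fin a) (Fin a) ℝ} (hA : IsUnit A) : Function.Injective (act A) :=
  Function.LeftInverse.injective (g := act A⁻¹) fun v => by
    rw [← mul_act, nonsing_inv_mul _ ((isUnit_iff_isUnit_det A).1 hA), one_act]

lemma inner_act_right (A : Matrix (Fin a) (Fin b) ℝ) (v : Vec a) (w : Vec b) :
    inner ℝ v (act A w) = inner ℝ (act Aᵀ v) w := by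
  simp only [act, EuclideanSpace.inner_eq_star_dotProduct, star_trivial]
  rw [mulVec_transpose, dotProduct_comm, dotProduct_mulVec, dotProduct_comm]

lemma inner_act_self_eq_zero {A : Matrix (Fin a) (Fin a) ℝ} (hA : A = -Aᵀ) (v : Vec a) :
    inner ℝ v (act A v) = 0 := by
  have h : inner ℝ v (act A v) = -inner ℝ v (act A v) := by
    conv_lhs => rw [inner_act_right, real_inner_comm]
    conv_rhs => rw [hA, neg_act, inner_neg_right, neg_neg]
  linarith

lemma inner_act_eq_dotProduct (A : Matrix (Fin a) (Fin a) ℝ) (v : Vec a) :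
    inner ℝ v (act A v) = star v.ofLp ⬝ᵥ (A *ᵥ v.ofLp) := by
  simp [act, EuclideanSpace.inner_eq_star_dotProduct, dotProduct_comm]

lemma inner_act_nonneg {A : Matrix (Fin a) (Fin a) ℝ} (hA : A.PosSemidef) (v : Vec a) :
    0 ≤ inner ℝ v (act A v) := by
  rw [inner_act_eq_dotProduct]
  exact hA.dotProduct_mulVec_nonneg _

lemma inner_act_pos {A : Matrix (Fin a) (Fin a) ℝ} (hA : A.PosDef) {v : Vec a} (hv : v ≠ 0) :
    0 < inner ℝ v (act A v) := by
  rw [inner_act_eq_dotProduct]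
  exact hA.dotProduct_mulVec_pos (by simpa using hv)

lemma continuous_act {X : Type*} [TopologicalSpace X] {A : X → Matrix (Fin a) (Fin b) ℝ}
    {v : X → Vec b} (hA : Continuous A) (hv : Continuous v) :
    Continuous fun x => act (A x) (v x) := by
  unfold act
  exact (PiLp.continuous_toLp 2 _).comp
    (hA.matrix_mulVec ((PiLp.continuous_ofLp 2 _).comp hv))

lemma SmoothMatrix.continuous {m p : ℕ} {A : Vec m × Vec p → Matrix (Fin a) (Fin b) ℝ}
    (hA : SmoothMatrix A) : Continuous A :=
  continuous_pi fun i => continuous_pi fun j => (hA i j).continuous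

end Act

/-! ### Partial gradients -/

section PartialGradients

variable {m p : ℕ} {H : Vec m × Vec p → ℝ}

lemma grad₁_eq (hH : Differentiable ℝ H) (x : Vec m × Vec p) :
    grad₁ H x = (InnerProductSpace.toDual ℝ (Vec m)).symm
      ((fderiv ℝ H x).comp (ContinuousLinearMap.inl ℝ (Vec m) (Vec p))) := by
  rw [grad₁, gradient]
  congr 1
  exact ((hH x).hasFDerivAt.comp x.1 (hasFDerivAt_prodMk_left x.1 x.2)).fderiv

lemma grad₂_eq (hH : Differentiable ℝ H) (x : Vec m × Vec p) :
    grad₂ H x = (InnerProductSpace.toDual ℝ (Vec p)).symm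
      ((fderiv ℝ H x).comp (ContinuousLinearMap.inr ℝ (Vec m) (Vec p))) := by
  rw [grad₂, gradient]
  congr 1
  exact ((hH x).hasFDerivAt.comp x.2 (hasFDerivAt_prodMk_right x.1 x.2)).fderiv

lemma fderiv_apply_eq_inner (hH : Differentiable ℝ H) (x v : Vec m × Vec p) :
    fderiv ℝ H x v = inner ℝ (grad₁ H x) v.1 + inner ℝ (grad₂ H x) v.2 := by
  rw [grad₁_eq hH, grad₂_eq hH, InnerProductSpace.toDual_symm_apply,
    InnerProductSpace.toDual_symm_apply]
  simp [← map_add]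

lemma contDiff_grad₁ (hH : ContDiff ℝ ∞ H) : ContDiff ℝ ∞ (grad₁ H) := by
  rw [funext (grad₁_eq (hH.differentiable (by simp)))]
  exact (InnerProductSpace.toDual ℝ (Vec m)).symm.contDiff.comp
    ((hH.fderiv_right (m := ∞) (by simp)).clm_comp contDiff_const)

lemma continuous_grad₂ (hH : ContDiff ℝ ∞ H) : Continuous (grad₂ H) := by
  rw [funext (grad₂_eq (hH.differentiable (by simp)))]
  exact (InnerProductSpace.toDual ℝ (Vec p)).symm.continuous.comp
    ((hH.continuous_fderiv (by simp)).clm_comp continuous_const)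

end PartialGradients

/-! ### Hamiltonians without cross terms -/

section Plant

variable {m p : ℕ} {P : Plant m p}

lemma Plant.differentiable_H (P : Plant m p) : Differentiable ℝ P.H :=
  P.smooth_H.differentiable (by simp)

lemma Plant.NoCrossTerms.grad₁_eq (h : P.NoCrossTerms) (x₁ : Vec m) (x₂ y₂ : Vec p) :
    grad₁ P.H (x₁, x₂) = grad₁ P.H (x₁, y₂) := by
  have hd : Differentiable ℝ (fun y => grad₁ P.H (x₁, y)) :=
    ((contDiff_grad₁ P.smooth_H).differentiable (by simp)).comp (by fun_prop)
  exact is_const_of_fderiv_eq_zero hd (fun y => h (x₁, y)) x₂ y₂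

/-- Without cross terms, `H` is a sum of a function of `x₁` and a function of `x₂`. -/
lemma Plant.NoCrossTerms.H_sub_eq (h : P.NoCrossTerms) (x₁ y₁ : Vec m) (x₂ y₂ : Vec p) :
    P.H (x₁, x₂) - P.H (x₁, y₂) = P.H (y₁, x₂) - P.H (y₁, y₂) := by
  have hd : ∀ (z : Vec p) (x : Vec m), HasFDerivAt (fun y => P.H (y, z))
      ((fderiv ℝ P.H (x, z)).comp (ContinuousLinearMap.inl ℝ (Vec m) (Vec p))) x := fun z x =>
    (P.differentiable_H (x, z)).hasFDerivAt.comp x (hasFDerivAt_prodMk_left x z)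
  refine is_const_of_fderiv_eq_zero (𝕜 := ℝ) (f := fun y => P.H (y, x₂) - P.H (y, y₂))
    (fun x => ((hd x₂ x).sub (hd y₂ x)).differentiableAt) (fun x => ?_) x₁ y₁
  refine ((hd x₂ x).sub (hd y₂ x)).fderiv.trans ?_
  ext v
  simp [fderiv_apply_eq_inner P.differentiable_H, h.grad₁_eq x x₂ y₂]

lemma Plant.NoCrossTerms.grad₂_eq (h : P.NoCrossTerms) (x₁ y₁ : Vec m) (x₂ : Vec p) :
    grad₂ P.H (x₁, x₂) = grad₂ P.H (y₁, x₂) := by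
  have : (fun y => P.H (x₁, y)) = fun y => P.H (y₁, y) + (P.H (x₁, x₂) - P.H (y₁, x₂)) := by
    funext y
    linarith [h.H_sub_eq x₁ y₁ x₂ y]
  simp only [grad₂, gradient, this, fderiv_add_const]

lemma Plant.StronglyConvex.strictConvexOn (h : P.StronglyConvex) :
    StrictConvexOn ℝ univ P.H := by
  obtain ⟨c, hc, hs⟩ := h
  refine ⟨convex_univ, fun x _ y _ hxy a b ha hb hab => ?_⟩
  exact (hs.strictConvexOn hc).2 (mem_univ (WithLp.toLp 2 x)) (mem_univ (WithLp.toLp 2 y))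
    (fun h => hxy (WithLp.toLp_injective 2 h)) ha hb hab

lemma Plant.StronglyConvex.eq_of_grad_eq (h : P.StronglyConvex) {x y : Vec m × Vec p}
    (h₁ : grad₁ P.H x = grad₁ P.H y) (h₂ : grad₂ P.H x = grad₂ P.H y) : x = y := by
  refine h.strictConvexOn.eq_of_hasFDerivAt (P.differentiable_H x).hasFDerivAt ?_
  have : fderiv ℝ P.H x = fderiv ℝ P.H y := by
    refine ContinuousLinearMap.ext fun v => ?_
    rw [fderiv_apply_eq_inner P.differentiable_H, fderiv_apply_eq_inner P.differentiable_H, h₁, h₂]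
  rw [this]
  exact (P.differentiable_H y).hasFDerivAt

/-- Without cross terms, `∇_{x₁} H` alone determines `x₁`: move both points to a common `x₂`, which
makes their full gradients equal. -/
lemma Plant.StronglyConvex.fst_eq_of_grad₁_eq (h : P.StronglyConvex) (hc : P.NoCrossTerms)
    {x y : Vec m × Vec p} (hxy : grad₁ P.H x = grad₁ P.H y) : x.1 = y.1 := by
  have := h.eq_of_grad_eq (x := (x.1, x.2)) (y := (y.1, x.2))
    (hxy.trans (hc.grad₁_eq y.1 y.2 x.2)) (hc.grad₂_eq x.1 y.1 x.2)
  exact (Prod.mk.inj this).1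

lemma Plant.StronglyConvex.snd_eq_of_grad₂_eq (h : P.StronglyConvex) (hc : P.NoCrossTerms)
    {x y : Vec m × Vec p} (hxy : grad₂ P.H x = grad₂ P.H y) : x.2 = y.2 := by
  have := h.eq_of_grad_eq (x := (x.1, x.2)) (y := (x.1, y.2)) (hc.grad₁_eq x.1 x.2 y.2)
    (hxy.trans (hc.grad₂_eq y.1 x.1 y.2))
  exact (Prod.mk.inj this).2

lemma Plant.NoCrossTerms.grad₂_eq_zero (h : P.NoCrossTerms) (x₁ : Vec m) :
    grad₂ P.H (x₁, P.xstar.2) = 0 := by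
  rw [h.grad₂_eq x₁ P.xstar.1]
  have hmin : IsLocalMin (fun y => P.H (P.xstar.1, y)) P.xstar.2 :=
    Filter.Eventually.of_forall fun y => by
      rcases eq_or_ne (P.xstar.1, y) P.xstar with hy | hy
      · simp [hy]
      · exact (P.strict_min _ hy).le
  simp [grad₂, gradient, hmin.fderiv_eq_zero]

lemma Plant.StronglyConvex.grad₂_eq_zero_iff (h : P.StronglyConvex) (hc : P.NoCrossTerms)
    {x : Vec m × Vec p} : grad₂ P.H x = 0 ↔ x.2 = P.xstar.2 := by
  refine ⟨fun hx => ?_, fun hx => ?_⟩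
  · exact h.snd_eq_of_grad₂_eq hc (y := (x.1, P.xstar.2)) (hx.trans (hc.grad₂_eq_zero x.1).symm)
  · rw [← hc.grad₂_eq_zero x.1, ← hx]

end Plant

/-! ### The closed loop and its shifted Hamiltonian -/

section ClosedLoop

variable {m p : ℕ} {P : Plant m p} {C : Controller m p} {d₂ : Vec p}
  {J₁₂ : Matrix (Fin m) (Fin p) ℝ} {q : Vec p}

/-- The argument `Eᵀ x₁ - ζ` of the controller Hamiltonian. -/
noncomputable def Controller.arg (C : Controller m p) (w : Vec m × Vec p × Vec p) : Vec p :=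
  act C.Eᵀ w.1 - w.2.2

/-- The gradient of the controller Hamiltonian at the closed loop state `w`. -/
noncomputable def Controller.costate (C : Controller m p) (w : Vec m × Vec p × Vec p) : Vec p :=
  gradient C.Hc (C.arg w)

/-- The partial gradient `∇_{x₁} Hcl = ∇_{x₁} H + E ∇Hc (Eᵀ x₁ - ζ)`. -/
noncomputable def closedLoopGrad₁ (P : Plant m p) (C : Controller m p)
    (w : Vec m × Vec p × Vec p) : Vec m :=
  grad₁ P.H (w.1, w.2.1) + act C.E (C.costate w)

lemma Controller.hasGradientAt (C : Controller m p) (z : Vec p) :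
    HasGradientAt C.Hc (gradient C.Hc z) z :=
  (C.contDiff_Hc.differentiable (by simp) z).hasGradientAt

lemma Controller.continuous_arg (C : Controller m p) : Continuous C.arg :=
  (continuous_act continuous_const continuous_fst).sub (by fun_prop)

lemma Controller.continuous_costate (C : Controller m p) : Continuous C.costate := by
  have : Continuous (gradient C.Hc) :=
    (InnerProductSpace.toDual ℝ (Vec p)).symm.continuous.comp
      (C.contDiff_Hc.continuous_fderiv (by simp))
  exact this.comp C.continuous_arg

lemma continuous_grad₁_state (P : Plant m p) :
    Continuous fun w : Vec m × Vec p × Vec p => grad₁ P.H (w.1, w.2.1) :=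
  (contDiff_grad₁ P.smooth_H).continuous.comp (by fun_prop)

lemma continuous_grad₂_state (P : Plant m p) :
    Continuous fun w : Vec m × Vec p × Vec p => grad₂ P.H (w.1, w.2.1) :=
  (continuous_grad₂ P.smooth_H).comp (by fun_prop)

lemma continuous_closedLoopGrad₁ (P : Plant m p) (C : Controller m p) :
    Continuous (closedLoopGrad₁ P C) :=
  (continuous_grad₁_state P).add (continuous_act continuous_const C.continuous_costate)

lemma Controller.hasGradientAt_fst (C : Controller m p) (x₁ : Vec m) (ζ : Vec p) :
    HasGradientAt (fun y => C.Hc (act C.Eᵀ y - ζ)) (act C.E (gradient C.Hc (act C.Eᵀ x₁ - ζ)))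
      x₁ := by
  have h := (hasGradientAt_iff_hasFDerivAt.1 (C.hasGradientAt (act C.Eᵀ x₁ - ζ))).comp x₁
    (((actCLM C.Eᵀ).hasFDerivAt (x := x₁)).sub_const ζ)
  refine hasGradientAt_iff_hasFDerivAt.2 (h.congr_fderiv ?_)
  ext v
  rw [ContinuousLinearMap.comp_apply, actCLM_apply, InnerProductSpace.toDual_apply_apply,
    InnerProductSpace.toDual_apply_apply, inner_act_right, transpose_transpose]

lemma gradHcl_eq (P : Plant m p) (C : Controller m p) (w : Vec m × Vec p × Vec p) :
    gradHcl P C w = (closedLoopGrad₁ P C w, grad₂ P.H (w.1, w.2.1), -C.costate w) := by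
  have h1 : HasGradientAt (fun y => P.H (y, w.2.1)) (grad₁ P.H (w.1, w.2.1)) w.1 :=
    ((P.differentiable_H (w.1, w.2.1)).comp w.1 (by fun_prop)).hasGradientAt
  have h3 : HasGradientAt (fun y => C.Hc (act C.Eᵀ w.1 - y)) (-C.costate w) w.2.2 := by
    have h := (hasGradientAt_iff_hasFDerivAt.1 (C.hasGradientAt (C.arg w))).comp w.2.2
      ((hasFDerivAt_id w.2.2).const_sub (act C.Eᵀ w.1))
    refine hasGradientAt_iff_hasFDerivAt.2 (h.congr_fderiv ?_)
    ext v
    simp [Controller.costate]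
  simp only [gradHcl, Hcl, Prod.mk.injEq]
  refine ⟨?_, ?_, ?_⟩
  · refine HasGradientAt.gradient (hasGradientAt_iff_hasFDerivAt.2 ?_)
    rw [closedLoopGrad₁, map_add]
    exact h1.hasFDerivAt.add (C.hasGradientAt_fst w.1 w.2.2).hasFDerivAt
  · simp only [gradient, grad₂, fderiv_add_const]
  · simp only [gradient, fderiv_const_add]
    exact h3.gradient

/-- With `q` the equilibrium value of `∇Hc`, the unmatched disturbance is absorbed in the
interconnection structure: the closed loop is driven by `∇_{x₁} Hcl`, `∇_{x₂} Hcl` and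
`∇Hc - q`. -/
lemma closedLoop_eq (hconst : ∀ x, P.J₁₂ x = J₁₂) (hq : act (J₁₂ᵀ * C.E) q = d₂)
    (w : Vec m × Vec p × Vec p) :
    closedLoop P C 0 d₂ w =
      (act J₁₂ (grad₂ P.H (w.1, w.2.1))
          + act (P.J₁ (w.1, w.2.1) - P.R₁ (w.1, w.2.1)) (closedLoopGrad₁ P C w),
        act (J₁₂ᵀ * C.E) (C.costate w - q)
          + (act (P.J₂ (w.1, w.2.1) - P.R₂ (w.1, w.2.1)) (grad₂ P.H (w.1, w.2.1))
            - act J₁₂ᵀ (closedLoopGrad₁ P C w)),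
        act (C.Eᵀ * J₁₂) (grad₂ P.H (w.1, w.2.1))) := by
  simp only [closedLoop, Plant.field, Controller.input, Controller.field, hconst,
    (C.hasGradientAt_fst w.1 w.2.2).gradient, closedLoopGrad₁, Prod.mk.injEq, act_add, act_sub, hq,
    mul_act, Controller.costate, Controller.arg]
  refine ⟨?_, ?_, trivial⟩ <;> abel

lemma continuous_closedLoop (hconst : ∀ x, P.J₁₂ x = J₁₂) (hq : act (J₁₂ᵀ * C.E) q = d₂) :
    Continuous (closedLoop P C 0 d₂) := by
  rw [funext (closedLoop_eq hconst hq)]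
  have hx : Continuous fun w : Vec m × Vec p × Vec p => (w.1, w.2.1) := by fun_prop
  have h1 := continuous_closedLoopGrad₁ P C
  have h2 := continuous_grad₂_state P
  refine ((continuous_act continuous_const h2).add (continuous_act ?_ h1)).prodMk
    (((continuous_act continuous_const (C.continuous_costate.sub continuous_const)).add
      ((continuous_act ?_ h2).sub (continuous_act continuous_const h1))).prodMk
        (continuous_act continuous_const h2))
  · exact (P.smooth_J₁.continuous.sub P.smooth_R₁.continuous).comp hx
  · exact (P.smooth_J₂.continuous.sub P.smooth_R₂.continuous).comp hx

/-- The shifted closed loop Hamiltonian, up to a constant the Bregman divergence of `Hcl` at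
a point where `∇_ζ Hcl = -q` and the other partial gradients vanish. -/
noncomputable def shiftedHcl (P : Plant m p) (C : Controller m p) (q : Vec p)
    (w : Vec m × Vec p × Vec p) : ℝ :=
  Hcl P C w + inner ℝ q w.2.2

/-- The derivative of `shiftedHcl`. -/
noncomputable def shiftedHclDeriv (P : Plant m p) (C : Controller m p) (q : Vec p)
    (w : Vec m × Vec p × Vec p) : Vec m × Vec p × Vec p →L[ℝ] ℝ :=
  (innerSL ℝ (closedLoopGrad₁ P C w)).comp (.fst ℝ _ _)
    + (innerSL ℝ (grad₂ P.H (w.1, w.2.1))).comp ((ContinuousLinearMap.fst ℝ _ _).comp (.snd ℝ _ _))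
    + (innerSL ℝ (q - C.costate w)).comp ((ContinuousLinearMap.snd ℝ _ _).comp (.snd ℝ _ _))

lemma shiftedHclDeriv_apply (w v : Vec m × Vec p × Vec p) :
    shiftedHclDeriv P C q w v = inner ℝ (closedLoopGrad₁ P C w) v.1
      + inner ℝ (grad₂ P.H (w.1, w.2.1)) v.2.1 + inner ℝ (q - C.costate w) v.2.2 := by
  simp [shiftedHclDeriv, inner_sub_left]

lemma hasFDerivAt_shiftedHcl (w : Vec m × Vec p × Vec p) :
    HasFDerivAt (shiftedHcl P C q) (shiftedHclDeriv P C q w) w := by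
  have hx : HasFDerivAt (fun w : Vec m × Vec p × Vec p => (w.1, w.2.1))
      ((ContinuousLinearMap.fst ℝ _ _).prod ((ContinuousLinearMap.fst ℝ _ _).comp
        (.snd ℝ _ _))) w :=
    hasFDerivAt_fst.prodMk (hasFDerivAt_fst.comp w hasFDerivAt_snd)
  have h1 := (P.differentiable_H (w.1, w.2.1)).hasFDerivAt.comp w hx
  have hz : HasFDerivAt C.arg ((actCLM C.Eᵀ).comp (.fst ℝ _ _)
      - (ContinuousLinearMap.snd ℝ _ _).comp (.snd ℝ _ _)) w :=
    ((actCLM C.Eᵀ).hasFDerivAt.comp w hasFDerivAt_fst).sub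
      (hasFDerivAt_snd.comp w hasFDerivAt_snd)
  have h2 := (hasGradientAt_iff_hasFDerivAt.1 (C.hasGradientAt (C.arg w))).comp w hz
  have h3 := (innerSL ℝ q).hasFDerivAt.comp w (hasFDerivAt_snd.comp w hasFDerivAt_snd)
  refine ((h1.add h2).add h3).congr_fderiv (ContinuousLinearMap.ext fun v => ?_)
  rw [shiftedHclDeriv_apply]
  simp only [_root_.add_apply, ContinuousLinearMap.comp_apply,
    fderiv_apply_eq_inner P.differentiable_H, ContinuousLinearMap.prod_apply,
    _root_.sub_apply, InnerProductSpace.toDual_apply_apply, actCLM_apply,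
    ContinuousLinearMap.coe_fst', ContinuousLinearMap.coe_snd', innerSL_apply_apply,
    closedLoopGrad₁, inner_add_left, inner_sub_left, inner_sub_right, inner_act_right,
    transpose_transpose, Controller.costate]
  ring

lemma strictConvexOn_shiftedHcl (h : P.StronglyConvex) :
    StrictConvexOn ℝ univ (shiftedHcl P C q) := by
  refine ⟨convex_univ, fun w _ v _ hwv a b ha hb hab => ?_⟩
  have hH := h.strictConvexOn
  have hC := C.strictConvex_Hc
  have harg : C.arg (a • w + b • v) = a • C.arg w + b • C.arg v := by
    simp only [Controller.arg, Prod.fst_add, Prod.snd_add, Prod.smul_fst, Prod.smul_snd, act_add,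
      act_smul]
    module
  have hlin : inner ℝ q (a • w + b • v).2.2 = a * inner ℝ q w.2.2 + b * inner ℝ q v.2.2 := by
    simp [inner_add_right, inner_smul_right]
  have hsum : ∀ w, shiftedHcl P C q w = P.H (w.1, w.2.1) + C.Hc (C.arg w) + inner ℝ q w.2.2 :=
    fun _ => rfl
  have h1 := hH.convexOn.2 (mem_univ (w.1, w.2.1)) (mem_univ (v.1, v.2.1)) ha.le hb.le hab
  have h2 := hC.convexOn.2 (mem_univ (C.arg w)) (mem_univ (C.arg v)) ha.le hb.le hab
  simp only [hsum, harg, hlin, smul_eq_mul] at h1 h2 ⊢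
  -- If the plant states differ, `H` is strict; otherwise `ζ`, hence the argument of `Hc`, differs.
  by_cases hx : (w.1, w.2.1) = (v.1, v.2.1)
  · have hz : C.arg w ≠ C.arg v := by
      intro hz
      obtain ⟨hx1, hx2⟩ := Prod.mk.inj hx
      simp only [Controller.arg, hx1] at hz
      exact hwv (Prod.ext hx1 (Prod.ext hx2 (sub_right_injective hz)))
    have h2' := hC.2 (mem_univ (C.arg w)) (mem_univ (C.arg v)) hz ha hb hab
    simp only [smul_eq_mul] at h2'
    change P.H (a • (w.1, w.2.1) + b • (v.1, v.2.1)) + _ + _ < _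
    linarith
  · have h1' := hH.2 (mem_univ (w.1, w.2.1)) (mem_univ (v.1, v.2.1)) hx ha hb hab
    simp only [smul_eq_mul] at h1'
    change P.H (a • (w.1, w.2.1) + b • (v.1, v.2.1)) + _ + _ < _
    linarith

/-- The power balance: the shifted Hamiltonian is dissipated through `R₁` and `R₂` only. -/
lemma shiftedHclDeriv_closedLoop (hconst : ∀ x, P.J₁₂ x = J₁₂) (hq : act (J₁₂ᵀ * C.E) q = d₂)
    (w : Vec m × Vec p × Vec p) :
    shiftedHclDeriv P C q w (closedLoop P C 0 d₂ w) =
      -(inner ℝ (closedLoopGrad₁ P C w) (act (P.R₁ (w.1, w.2.1)) (closedLoopGrad₁ P C w))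
        + inner ℝ (grad₂ P.H (w.1, w.2.1))
            (act (P.R₂ (w.1, w.2.1)) (grad₂ P.H (w.1, w.2.1)))) := by
  rw [shiftedHclDeriv_apply, closedLoop_eq hconst hq]
  have hM : (C.Eᵀ * J₁₂) = (J₁₂ᵀ * C.E)ᵀ := by simp
  simp only [hM]
  set M := J₁₂ᵀ * C.E
  set a := closedLoopGrad₁ P C w
  set g := grad₂ P.H (w.1, w.2.1)
  have h1 := inner_act_self_eq_zero (P.skew_J₁ (w.1, w.2.1)) a
  have h2 := inner_act_self_eq_zero (P.skew_J₂ (w.1, w.2.1)) g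
  have h3 : inner ℝ g (act J₁₂ᵀ a) = inner ℝ a (act J₁₂ g) := by
    rw [inner_act_right, transpose_transpose, real_inner_comm]
  have h4 : inner ℝ (q - C.costate w) (act Mᵀ g) = -inner ℝ g (act M (C.costate w - q)) := by
    rw [inner_act_right, transpose_transpose, real_inner_comm, ← neg_sub, act_neg, inner_neg_right]
  rw [h4]
  simp only [sub_act, inner_add_right, inner_sub_right, h1, h2, h3]
  ring

/-- The closed loop state is determined by the three gradients that drive the dynamics. -/
lemma eq_of_gradients_eq (hcross : P.NoCrossTerms) (hconvex : P.StronglyConvex)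
    {w v : Vec m × Vec p × Vec p} (h1 : closedLoopGrad₁ P C w = closedLoopGrad₁ P C v)
    (h2 : grad₂ P.H (w.1, w.2.1) = grad₂ P.H (v.1, v.2.1)) (h3 : C.costate w = C.costate v) :
    w = v := by
  have hx2 : w.2.1 = v.2.1 := hconvex.snd_eq_of_grad₂_eq hcross h2
  have hx1 : w.1 = v.1 := by
    rw [closedLoopGrad₁, closedLoopGrad₁, h3, add_left_inj] at h1
    exact hconvex.fst_eq_of_grad₁_eq hcross h1
  have hz := C.bijective_grad.1 h3
  simp only [Controller.arg, hx1] at hz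
  exact Prod.ext hx1 (Prod.ext hx2 (sub_right_injective hz))

end ClosedLoop

/-! ### Attractivity -/

section Attractivity

variable {m p : ℕ} {P : Plant m p} {C : Controller m p} {d₂ : Vec p}
  {J₁₂ : Matrix (Fin m) (Fin p) ℝ} {q : Vec p}

/-- Attractivity: every forward solution converges to the point where `∇_{x₁} Hcl` and `∇_{x₂} H`
vanish and `∇Hc` equals `q`. -/
theorem tendsto_of_isSolutionOn (hcross : P.NoCrossTerms) (hconvex : P.StronglyConvex)
    (hconst : ∀ x, P.J₁₂ x = J₁₂) (hinv : IsUnit (J₁₂ᵀ * C.E)) (hq : act (J₁₂ᵀ * C.E) q = d₂)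
    {e : Vec m × Vec p × Vec p} (hK : ∀ c, IsCompact {w | shiftedHcl P C q w ≤ c})
    (hmin : ∀ w, shiftedHcl P C q e ≤ shiftedHcl P C q w)
    (he₁ : closedLoopGrad₁ P C e = 0) (he₂ : grad₂ P.H (e.1, e.2.1) = 0) (he₃ : C.costate e = q)
    {w : ℝ → Vec m × Vec p × Vec p} (hw : IsSolutionOn (closedLoop P C 0 d₂) w (Ici 0)) :
    Tendsto w atTop (𝓝 e) := by
  set V := shiftedHcl P C q with hVdef
  have hf := continuous_closedLoop hconst hq
  have hx : Continuous fun w : Vec m × Vec p × Vec p => (w.1, w.2.1) := by fun_prop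
  have hca := continuous_closedLoopGrad₁ P C
  have hcg := continuous_grad₂_state P
  have hcq := C.continuous_costate
  let D : Vec m × Vec p × Vec p → ℝ := fun w =>
    -(inner ℝ (closedLoopGrad₁ P C w) (act (P.R₁ (w.1, w.2.1)) (closedLoopGrad₁ P C w))
        + inner ℝ (grad₂ P.H (w.1, w.2.1)) (act (P.R₂ (w.1, w.2.1)) (grad₂ P.H (w.1, w.2.1))))
  have hD0 : ∀ w, D w ≤ 0 := fun w =>
    neg_nonpos.2 (add_nonneg (inner_act_nonneg (P.posDef_R₁ _).posSemidef _)
      (inner_act_nonneg (P.posSemidef_R₂ _) _))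
  have hDc : Continuous D :=
    ((hca.inner (continuous_act (P.smooth_R₁.continuous.comp hx) hca)).add
      (hcg.inner (continuous_act (P.smooth_R₂.continuous.comp hx) hcg))).neg
  have hDa : ∀ w, D w = 0 → closedLoopGrad₁ P C w = 0 := by
    intro w hw
    by_contra hne
    have h1 := inner_act_pos (P.posDef_R₁ (w.1, w.2.1)) hne
    have h2 := inner_act_nonneg (P.posSemidef_R₂ (w.1, w.2.1)) (grad₂ P.H (w.1, w.2.1))
    simp only [D] at hw
    linarith
  have hpow : ∀ w, shiftedHclDeriv P C q w (closedLoop P C 0 d₂ w) = D w :=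
    shiftedHclDeriv_closedLoop hconst hq
  have hanti := hw.antitoneOn (convex_Ici 0) hasFDerivAt_shiftedHcl fun w =>
    (hpow w).trans_le (hD0 w)
  have hwK : ∀ t, 0 ≤ t → w t ∈ {x | V x ≤ V (w 0)} := fun t ht => hanti self_mem_Ici ht ht
  have hK0 := hK (V (w 0))
  have hwK' : ∀ᶠ t in atTop, w t ∈ {x | V x ≤ V (w 0)} :=
    (eventually_ge_atTop 0).mono hwK
  have hwKK : ∀ h, 0 < h → ∀ᶠ t in atTop, (w t, w (t + h)) ∈
      {x | V x ≤ V (w 0)} ×ˢ {x | V x ≤ V (w 0)} := fun h hh =>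
    (eventually_ge_atTop 0).mono fun t ht => ⟨hwK t ht, hwK _ (by linarith)⟩
  have huc : ∀ {n : ℕ} {φ : Vec m × Vec p × Vec p → Vec n}, Continuous φ →
    UniformContinuousOn (fun t => φ (w t)) (Ici 0) := fun hφ =>
      hw.uniformContinuousOn_comp hf hK0 hwK hφ
  have hd : ∀ t, 0 ≤ t → HasDerivWithinAt w (closedLoop P C 0 d₂ (w t)) (Ici 0) t :=
    fun t ht => hw t ht
  have hd₁ := fun t ht => (hasFDerivAt_fst (𝕜 := ℝ) (p := w t)).comp_hasDerivWithinAt t (hd t ht)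
  have hd₂ := fun t ht => (hasFDerivAt_snd (𝕜 := ℝ) (p := w t)).comp_hasDerivWithinAt t (hd t ht)
  have hx₂ := fun t ht =>
    (hasFDerivAt_fst (𝕜 := ℝ) (p := (w t).2)).comp_hasDerivWithinAt t (hd₂ t ht)
  have hζ := fun t ht =>
    (hasFDerivAt_snd (𝕜 := ℝ) (p := (w t).2)).comp_hasDerivWithinAt t (hd₂ t ht)
  -- The shifted Hamiltonian converges, so its rate of dissipation tends to zero.
  have hDlim : Tendsto (fun t => D (w t)) atTop (𝓝 0) := by
    have hVlim : ∃ c, Tendsto (fun t => V (w t)) atTop (𝓝 c) := by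
      have hanti' : Antitone fun t => V (w (max t 0)) := fun s t hst =>
        hanti (mem_Ici.2 (le_max_right _ _)) (mem_Ici.2 (le_max_right _ _))
          (max_le_max_right 0 hst)
      refine ⟨_, (tendsto_atTop_ciInf hanti' ⟨V e, ?_⟩).congr' ?_⟩
      · rintro _ ⟨t, rfl⟩
        exact hmin _
      · filter_upwards [eventually_ge_atTop 0] with t ht
        rw [max_eq_left ht]
    obtain ⟨c, hc⟩ := hVlim
    refine tendsto_zero_of_increments (y := fun t => V (w t)) (r := fun _ => 0) (fun t ht => ?_)
      (hw.uniformContinuousOn_comp hf hK0 hwK hDc) tendsto_const_nhds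
      (fun h _ => increments_tendsto_zero_of_tendsto hc h)
    rw [add_zero, ← hpow]
    exact (hasFDerivAt_shiftedHcl (w t)).comp_hasDerivWithinAt t (hd t ht)
  have ha : Tendsto (fun t => closedLoopGrad₁ P C (w t)) atTop (𝓝 0) :=
    tendsto_of_isCompact hK0 hwK' hDc hca hDa hDlim
  have hJR : Continuous fun w : Vec m × Vec p × Vec p =>
      act (P.J₁ (w.1, w.2.1) - P.R₁ (w.1, w.2.1)) (closedLoopGrad₁ P C w) :=
    continuous_act ((P.smooth_J₁.continuous.sub P.smooth_R₁.continuous).comp hx) hca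
  have hJR₂ : Continuous fun w : Vec m × Vec p × Vec p =>
      act (P.J₂ (w.1, w.2.1) - P.R₂ (w.1, w.2.1)) (grad₂ P.H (w.1, w.2.1))
        - act J₁₂ᵀ (closedLoopGrad₁ P C w) :=
    (continuous_act ((P.smooth_J₂.continuous.sub P.smooth_R₂.continuous).comp hx) hcg).sub
      (continuous_act continuous_const hca)
  have hr₁ : Tendsto (fun t => act (P.J₁ ((w t).1, (w t).2.1) - P.R₁ ((w t).1, (w t).2.1))
      (closedLoopGrad₁ P C (w t))) atTop (𝓝 0) :=
    tendsto_of_isCompact hK0 hwK' hca hJR (fun x hx => by rw [hx, act_zero]) ha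
  -- `Eᵀ x₁ - ζ` only moves through `∇_{x₁} Hcl`, since the `x₂` terms cancel.
  have hzinc : ∀ h, 0 < h → Tendsto (fun t => C.arg (w (t + h)) - C.arg (w t)) atTop (𝓝 0) := by
    intro h hh
    refine increments_tendsto_zero (y := fun t => C.arg (w t)) (fun t ht => ?_)
      (((actCLM C.Eᵀ).continuous.tendsto' 0 0 (map_zero _)).comp hr₁) hh
    refine (((actCLM C.Eᵀ).hasFDerivAt.comp_hasDerivWithinAt t (hd₁ t ht)).sub
      (hζ t ht)).congr_deriv ?_
    simp only [closedLoop_eq hconst hq, ContinuousLinearMap.coe_fst', ContinuousLinearMap.coe_snd',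
      Function.comp_apply, map_add, actCLM_apply, mul_act]
    abel
  -- As `∇_{x₁} H = -E ∇Hc (Eᵀ x₁ - ζ)` in the limit, `x₁` also becomes stationary.
  have hxinc : ∀ h, 0 < h → Tendsto (fun t => (w (t + h)).1 - (w t).1) atTop (𝓝 0) := by
    intro h hh
    refine tendsto_of_isCompact (hK0.prod hK0) (hwKK h hh)
      (φ := fun u => (closedLoopGrad₁ P C u.1, closedLoopGrad₁ P C u.2, C.arg u.2 - C.arg u.1))
      (ψ := fun u => u.2.1 - u.1.1) (y := (0, 0, 0))
      ((hca.comp continuous_fst).prodMk ((hca.comp continuous_snd).prodMk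
        ((C.continuous_arg.comp continuous_snd).sub (C.continuous_arg.comp continuous_fst))))
      (by fun_prop) ?_ (ha.prodMk_nhds
        ((ha.comp (tendsto_atTop_add_const_right _ h tendsto_id)).prodMk_nhds (hzinc h hh)))
    intro u hu
    obtain ⟨h1, h2, h3⟩ : _ ∧ _ ∧ _ := by simpa only [Prod.mk.injEq] using hu
    have h4 : C.costate u.2 = C.costate u.1 := by
      rw [Controller.costate, sub_eq_zero.1 h3, Controller.costate]
    rw [closedLoopGrad₁] at h1 h2
    rw [h4, ← h1, add_left_inj] at h2
    exact sub_eq_zero.2 (hconvex.fst_eq_of_grad₁_eq hcross h2)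
  -- The drift `J₁₂ ∇_{x₂} H` of the stationary `x₁` dies out, and with it `∇_{x₂} H`.
  have hJg : Tendsto (fun t => act J₁₂ (grad₂ P.H ((w t).1, (w t).2.1))) atTop (𝓝 0) := by
    refine tendsto_zero_of_increments (y := fun t => (w t).1) (fun t ht => ?_)
      (huc (continuous_act continuous_const hcg)) hr₁ hxinc
    refine (hd₁ t ht).congr_deriv ?_
    rw [closedLoop_eq hconst hq]
    rfl
  have hinvT : IsUnit (C.Eᵀ * J₁₂) := by
    rw [← transpose_transpose J₁₂, ← transpose_mul]
    exact (isUnit_transpose _).2 hinv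
  have hJg0 : ∀ x : Vec m × Vec p × Vec p, act J₁₂ (grad₂ P.H (x.1, x.2.1)) = 0 →
      grad₂ P.H (x.1, x.2.1) = 0 := fun x hx =>
    act_injective hinvT (by rw [mul_act, hx, act_zero, act_zero])
  have hg : Tendsto (fun t => grad₂ P.H ((w t).1, (w t).2.1)) atTop (𝓝 0) :=
    tendsto_of_isCompact hK0 hwK' (continuous_act continuous_const hcg) hcg hJg0 hJg
  have hx₂lim : Tendsto (fun t => (w t).2.1) atTop (𝓝 P.xstar.2) :=
    tendsto_of_isCompact hK0 hwK' hcg (ψ := fun u => u.2.1) (by fun_prop)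
      (fun u hu => (hconvex.grad₂_eq_zero_iff hcross).1 hu) hg
  have hr₂ : Tendsto (fun t => act (P.J₂ ((w t).1, (w t).2.1) - P.R₂ ((w t).1, (w t).2.1))
      (grad₂ P.H ((w t).1, (w t).2.1)) - act J₁₂ᵀ (closedLoopGrad₁ P C (w t))) atTop (𝓝 0) :=
    tendsto_of_isCompact hK0 hwK' (hca.prodMk hcg) hJR₂ (y := (0, 0))
      (fun u hu => by
        obtain ⟨h1, h2⟩ := Prod.mk.inj hu
        rw [h1, h2, act_zero, act_zero, sub_zero]) (ha.prodMk_nhds hg)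
  have hcMq : Continuous fun w => act (J₁₂ᵀ * C.E) (C.costate w - q) :=
    continuous_act continuous_const (hcq.sub continuous_const)
  -- The same argument for `x₂`, which converges, yields the limit of `∇Hc`.
  have hMq : Tendsto (fun t => act (J₁₂ᵀ * C.E) (C.costate (w t) - q)) atTop (𝓝 0) := by
    refine tendsto_zero_of_increments (y := fun t => (w t).2.1) (fun t ht => ?_) (huc hcMq) hr₂
      fun h _ => increments_tendsto_zero_of_tendsto hx₂lim h
    refine (hx₂ t ht).congr_deriv ?_
    rw [closedLoop_eq hconst hq]
    rfl
  refine tendsto_of_isCompact hK0 hwK' (hca.prodMk (hcg.prodMk hcMq)) (ψ := id) continuous_id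
    (y := (0, 0, 0)) (fun u hu => ?_) (ha.prodMk_nhds (hg.prodMk_nhds hMq))
  obtain ⟨h1, h2, h3⟩ : _ ∧ _ ∧ _ := by simpa only [Prod.mk.injEq] using hu
  have h4 : C.costate u - q = 0 := act_injective hinv (h3.trans (act_zero _).symm)
  exact eq_of_gradients_eq hcross hconvex (h1.trans he₁.symm) (h2.trans he₂.symm)
    ((sub_eq_zero.1 h4).trans he₃.symm)

end Attractivity

end PortHamiltonian

theorem proposition2 {m p : ℕ}
    (P : PortHamiltonian.Plant m p) (C : PortHamiltonian.Controller m p)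
    (d₂ : PortHamiltonian.Vec p)
    (hJ₁₂ : ∀ x, PortHamiltonian.IsFullRank (P.J₁₂ x))
    (hR₁ : ∀ x, PortHamiltonian.IsFullRank (P.R₁ x))
    (hcross : P.NoCrossTerms)
    (hconvex : P.StronglyConvex)
    (J₁₂ : Matrix (Fin m) (Fin p) ℝ) (hconst : ∀ x, P.J₁₂ x = J₁₂)
    (hinv : IsUnit (J₁₂ᵀ * C.E))
    (x₁bar : PortHamiltonian.Vec m)
    (hx₁bar : ∀ x₁ : PortHamiltonian.Vec m,
      PortHamiltonian.grad₁ P.H (x₁, P.xstar.2)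
          = -PortHamiltonian.act (C.E * (J₁₂ᵀ * C.E)⁻¹) d₂ ↔ x₁ = x₁bar) :
    ∃ ζbar : PortHamiltonian.Vec p,
      (∀ w, PortHamiltonian.gradHcl P C w
          = (0, 0, -PortHamiltonian.act (J₁₂ᵀ * C.E)⁻¹ d₂) ↔ w = (x₁bar, P.xstar.2, ζbar)) ∧
      PortHamiltonian.IsGloballyAsymptoticallyStable
        (PortHamiltonian.closedLoop P C 0 d₂) (x₁bar, P.xstar.2, ζbar) := by
  open PortHamiltonian in
  set q := act (J₁₂ᵀ * C.E)⁻¹ d₂ with hqdef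
  have hq : act (J₁₂ᵀ * C.E) q = d₂ := by
    rw [hqdef, ← mul_act, mul_nonsing_inv _ ((isUnit_iff_isUnit_det _).1 hinv), one_act]
  obtain ⟨zbar, hz⟩ := C.bijective_grad.2 q
  set e : Vec m × Vec p × Vec p := (x₁bar, P.xstar.2, act C.Eᵀ x₁bar - zbar) with he
  have he₃ : C.costate e = q := by
    rw [Controller.costate, Controller.arg, sub_sub_cancel]
    exact hz
  have he₂ : grad₂ P.H (e.1, e.2.1) = 0 := hcross.grad₂_eq_zero x₁bar
  have he₁ : closedLoopGrad₁ P C e = 0 := by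
    rw [closedLoopGrad₁, he₃, (hx₁bar e.1).2 rfl, mul_act, neg_add_cancel]
  have hderiv : shiftedHclDeriv P C q e = 0 := by
    refine ContinuousLinearMap.ext fun v => ?_
    rw [shiftedHclDeriv_apply, he₁, he₂, he₃]
    simp
  have hstrict := strictConvexOn_shiftedHcl (C := C) (q := q) hconvex
  have hmin : ∀ w, w ≠ e → shiftedHcl P C q e < shiftedHcl P C q w := fun w hw => by
    simpa [hderiv] using hstrict.add_fderiv_lt (hasFDerivAt_shiftedHcl e) hw
  have hVc : Continuous (shiftedHcl P C q) :=
    continuous_iff_continuousAt.2 fun w => (hasFDerivAt_shiftedHcl w).continuousAt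
  have hgrow := fun (ε : ℝ) (hε : ε > 0) => hstrict.convexOn.exists_linear_growth hVc hmin hε
  have hK : ∀ c, IsCompact {w | shiftedHcl P C q w ≤ c} := by
    obtain ⟨μ, hμ, h⟩ := hgrow 1 one_pos
    exact isCompact_sublevel_of_linear_growth hVc hμ h
  refine ⟨act C.Eᵀ x₁bar - zbar, fun w => ?_, ?_⟩
  · rw [gradHcl_eq, Prod.mk.injEq, Prod.mk.injEq, neg_inj]
    refine ⟨fun ⟨h1, h2, h3⟩ => ?_, ?_⟩
    · exact eq_of_gradients_eq hcross hconvex (h1.trans he₁.symm) (h2.trans he₂.symm)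
        (h3.trans he₃.symm)
    · rintro rfl
      exact ⟨he₁, he₂, he₃⟩
  · refine IsGloballyAsymptoticallyStable.of_lyapunov (continuous_closedLoop hconst hq)
      hasFDerivAt_shiftedHcl (fun w => ?_) ?_ hgrow fun w hw => ?_
    · rw [shiftedHclDeriv_closedLoop hconst hq]
      exact neg_nonpos.2 (add_nonneg (inner_act_nonneg (P.posDef_R₁ _).posSemidef _)
        (inner_act_nonneg (P.posSemidef_R₂ _) _))
    · rw [closedLoop_eq hconst hq, he₁, he₂, he₃]
      simp [act_zero]
    · exact tendsto_of_isSolutionOn hcross hconvex hconst hinv hq hK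
        (fun w => (eq_or_ne w e).elim (fun h => h ▸ le_rfl) fun h => (hmin w h).le) he₁ he₂ he₃ hw
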